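/- For complex $p$ with $|p|<1$ and $z\neq0$ let $\theta(z;p)=\prod_{j\ge0}(1-zp^j)(1-p^{j+1}/z)$, and let $(x;q,p)_n=\prod_{j=0}^{n-1}\theta(xq^j;p)$ for $n\ge 0$. Sequences $(\alpha_n)_{n\ge0}$, $(\beta_n)_{n\ge0}$ of complex numbers form an elliptic WP Bailey pair at $(a,k;q,p)$ if for all $n\ge0$ $$\beta_n=\sum_{r=0}^n\frac{(k/a;q,p)_{n-r}}{(q;q,p)_{n-r}}\frac{(k;q,p)_{n+r}}{(aq;q,p)_{n+r}}\,\alpha_r$$ and $$\alpha_n=\frac{\theta(aq^{2n};p)}{\theta(a;p)}\sum_{r=0}^n\frac{\theta(kq^{2r};p)}{\theta(k;p)}\frac{(a/k;q,p)_{n-r}}{(q;q,p)_{n-r}}\frac{(a;q,p)_{n+r}}{(kq;q,p)_{n+r}}\Bigl(\frac ka\Bigr)^{n-r}\beta_r .$$ **Theorem 5.2.** Let $a,k,q,p$ be complex numbers with $a,k,q\ne0$ and $|p|<1$, and let $m=a/(kq)$. Assume the parameters are generic, i.e. for all $n\ge0$ none of $\theta(q^{2n+2};p^2)$, $\theta(aq^{2n};p^2)$,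 $\theta(k^2q^{2n};p^2)$, $\theta(m^2q^{2n};p^2)$ vanishes. If $(\alpha,\beta)$ is an elliptic WP Bailey pair at $(a,m^2;q^2,p^2)$, then $(\alpha',\beta')$ is an elliptic WP Bailey pair at $(a,k^2;q^2,p^2)$, where for all $n\ge0$ $$\alpha'_n=\frac{(-mq;q,p)_{2n}}{(-kq;q,p)_{2n}}\Bigl(\frac{a}{m^2q}\Bigr)^n\alpha_n,$$ $$\beta'_n=\frac{\theta(-k;p)}{\theta(-kq^{2n};p)}\,q^{-n}\sum_{r=0}^n\frac{\theta(m^2q^{4r};p^2)}{\theta(m^2;p^2)}\frac{(k/m;q,p)_{n-r}}{(q;q,p)_{n-r}}\frac{(k;q,p)_{n+r}}{(mq;q,p)_{n+r}}\Bigl(\frac{a}{m^2}\Bigr)^r\beta_r .$$ -/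

import Mathlib

/-- The modified Jacobi theta function
`θ(z;p) = ∏_{j ≥ 0} (1 - z p^j) (1 - p^(j+1) / z)`, used for `z ≠ 0` and `|p| < 1`. -/
noncomputable def ellTheta (z p : ℂ) : ℂ :=
  ∏' j : ℕ, (1 - z * p ^ j) * (1 - p ^ (j + 1) / z)

/-- The elliptic shifted factorial `(a;q,p)_n = ∏_{j=0}^{n-1} θ(a q^j;p)`. -/
noncomputable def ellPoch (a q p : ℂ) (n : ℕ) : ℂ :=
  ∏ j ∈ Finset.range n, ellTheta (a * q ^ j) p

/-- The sequences `α`, `β` form an elliptic WP Bailey pair at `(a, k; q, p)`: they satisfy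
both equations of the elliptic WP Bailey transform, the one giving `β` in terms of `α`
and the inverse one giving `α` in terms of `β`. -/
def IsEllipticWPBaileyPair (a k q p : ℂ) (α β : ℕ → ℂ) : Prop :=
  (∀ n : ℕ, β n = ∑ r ∈ Finset.range (n + 1),
      ellPoch (k / a) q p (n - r) / ellPoch q q p (n - r) *
        (ellPoch k q p (n + r) / ellPoch (a * q) q p (n + r)) * α r) ∧
  (∀ n : ℕ, α n = ellTheta (a * q ^ (2 * n)) p / ellTheta a p *
      ∑ r ∈ Finset.range (n + 1),
        ellTheta (k * q ^ (2 * r)) p / ellTheta k p *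
          (ellPoch (a / k) q p (n - r) / ellPoch q q p (n - r)) *
          (ellPoch a q p (n + r) / ellPoch (k * q) q p (n + r)) *
          (k / a) ^ (n - r) * β r)

/-! Insert the formula for `β` in terms of `α` into the definition of `β'` and exchange the sums.
The formula for `β'` in terms of `α'` then holds coefficientwise in `α`, provided a terminating
quadratic summation, mixing nomes `p` and `p ^ 2`, evaluates the inner sum (`quadSum_eq`). The
inverse formula is automatic for generic parameters, because the two triangular matrices of the
transform are mutually inverse (`isEllipticWPBaileyPair_of_beta`).

Both facts rest on one summation by parts with a free parameter `b` (`sum_mul_baileyEntry`), which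
is the theta addition formula in disguise. For matrix inversion, a suitable `b` makes every summand
and the boundary term vanish. For the quadratic sum, two choices of `b`, one for length `N + 1` and
one for length `N`, make the two sums proportional term by term. The result is a first-order
recurrence in `N` that the closed form also satisfies.

The theta identities come from Jacobi's triple product. Splitting a product of two theta series by
parity gives `θ(x;p) θ(y;p) = F(xy) g(x/y) - y g(xy) F(x/y)` with `F(w) = θ(-w;p²)`, essentially a 2
× 2 determinant in the vectors `(F, g)`. The addition formula is the Plücker relation between four
such vectors. The quadratic relation, which governs the term-by-term comparison, is the linear
relation between the determinants of three vectors. -/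

open Filter Topology

/-! ### Gaussian binomials and the terminating q-binomial theorem -/

/-- The Gaussian binomial coefficient, evaluated at `p`. -/
noncomputable def gaussBinom (p : ℂ) : ℕ → ℕ → ℂ
  | _, 0 => 1
  | 0, _ + 1 => 0
  | n + 1, i + 1 => p ^ (i + 1) * gaussBinom p n (i + 1) + gaussBinom p n i

lemma gaussBinom_zero_right (p : ℂ) (n : ℕ) : gaussBinom p n 0 = 1 := by
  cases n <;> rfl

lemma gaussBinom_succ_succ (p : ℂ) (n i : ℕ) : gaussBinom p (n + 1) (i + 1) =
    p ^ (i + 1) * gaussBinom p n (i + 1) + gaussBinom p n i := rfl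

lemma gaussBinom_of_lt (p : ℂ) {n i : ℕ} (h : n < i) : gaussBinom p n i = 0 := by
  induction n generalizing i with
  | zero => obtain ⟨i, rfl⟩ := Nat.exists_eq_succ_of_ne_zero h.ne'; rfl
  | succ n ih =>
    obtain ⟨i, rfl⟩ := Nat.exists_eq_succ_of_ne_zero (Nat.ne_zero_of_lt h)
    rw [Nat.succ_eq_add_one, gaussBinom_succ_succ, ih (by omega), ih (by omega)]; simp

/-- The finite Euler product `∏_{j=1}^{n} (1 - p^j)`. -/
noncomputable def eulerProd (p : ℂ) (n : ℕ) : ℂ := ∏ j ∈ Finset.range n, (1 - p ^ (j + 1))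

lemma gaussBinom_mul_eulerProd (p : ℂ) (i j : ℕ) :
    gaussBinom p (i + j) i * (eulerProd p i * eulerProd p j) = eulerProd p (i + j) := by
  induction i generalizing j with
  | zero => simp [gaussBinom_zero_right, eulerProd]
  | succ i ihi =>
    induction j with
    | zero =>
      have h := ihi 0
      rw [Nat.add_zero] at h ⊢
      rw [gaussBinom_succ_succ, gaussBinom_of_lt p (Nat.lt_succ_self i)]
      simp only [eulerProd, Finset.prod_range_succ, Finset.prod_range_zero] at h ⊢
      linear_combination (1 - p ^ (i + 1)) * h
    | succ j ihj =>
      have h := ihi (j + 1)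
      rw [show i + 1 + (j + 1) = (i + 1 + j) + 1 by ring, gaussBinom_succ_succ]
      rw [show i + (j + 1) = i + 1 + j by ring] at h
      simp only [eulerProd, Finset.prod_range_succ] at h ihj ⊢
      linear_combination p ^ (i + 1) * (1 - p ^ (j + 1)) * ihj + (1 - p ^ (i + 1)) * h

/-- The terminating `q`-binomial theorem. -/
lemma prod_one_sub_mul_pow (p x : ℂ) (n : ℕ) :
    ∏ j ∈ Finset.range n, (1 - x * p ^ j) =
      ∑ i ∈ Finset.range (n + 1), gaussBinom p n i * p ^ (i.choose 2) * (-x) ^ i := by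
  induction n generalizing x with
  | zero => simp [gaussBinom_zero_right]
  | succ n ih =>
    rw [Finset.prod_range_succ']
    have h1 : ∏ j ∈ Finset.range n, (1 - x * p ^ (j + 1)) =
        ∏ j ∈ Finset.range n, (1 - (x * p) * p ^ j) :=
      Finset.prod_congr rfl fun j _ => by ring
    rw [h1, ih, Finset.sum_range_succ' _ (n + 1)]
    have h2 : ∀ i, gaussBinom p (n + 1) (i + 1) * p ^ ((i + 1).choose 2) * (-x) ^ (i + 1) =
        gaussBinom p n (i + 1) * p ^ ((i + 1).choose 2) * (-(x * p)) ^ (i + 1) +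
          (-x) * (gaussBinom p n i * p ^ (i.choose 2) * (-(x * p)) ^ i) := by
      intro i
      rw [gaussBinom_succ_succ, Nat.choose_succ_succ' i 1, Nat.choose_one_right, neg_mul_eq_neg_mul,
        mul_pow, mul_pow]
      ring
    simp_rw [h2]
    rw [Finset.sum_add_distrib, ← Finset.mul_sum]
    have h3 := Finset.sum_range_succ'
      (fun i => gaussBinom p n i * p ^ (i.choose 2) * (-(x * p)) ^ i) (n + 1)
    rw [Finset.sum_range_succ, gaussBinom_of_lt p (Nat.lt_succ_self n)] at h3
    simp only [gaussBinom_zero_right] at h3 ⊢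
    norm_num at h3 ⊢
    linear_combination h3

/-! ### Convergence of the products and elementary properties of theta -/

lemma norm_pow_succ_lt_one {p : ℂ} (hp : ‖p‖ < 1) (j : ℕ) : ‖p ^ (j + 1)‖ < 1 := by
  rw [norm_pow]; exact pow_lt_one₀ (norm_nonneg _) hp (Nat.succ_ne_zero j)

lemma one_sub_pow_succ_ne_zero {p : ℂ} (hp : ‖p‖ < 1) (j : ℕ) : 1 - p ^ (j + 1) ≠ 0 := by
  intro h
  have := norm_pow_succ_lt_one hp j
  rw [← sub_eq_zero.mp h] at this
  simp at this

lemma eulerProd_ne_zero {p : ℂ} (hp : ‖p‖ < 1) (n : ℕ) : eulerProd p n ≠ 0 :=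
  Finset.prod_ne_zero_iff.mpr fun j _ => one_sub_pow_succ_ne_zero hp j

lemma summable_norm_pow {p : ℂ} (hp : ‖p‖ < 1) : Summable fun j : ℕ => ‖p ^ j‖ := by
  simpa using summable_geometric_of_lt_one (norm_nonneg p) hp

lemma exists_tendsto_eulerProd {p : ℂ} (hp : ‖p‖ < 1) :
    ∃ c : ℂ, c ≠ 0 ∧ Tendsto (eulerProd p) atTop (𝓝 c) := by
  have hs : Summable fun j : ℕ => ‖-p ^ (j + 1)‖ := by
    simpa using (summable_nat_add_iff 1).mpr (summable_norm_pow hp)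
  refine ⟨∏' j : ℕ, (1 + -p ^ (j + 1)), tprod_one_add_ne_zero_of_summable
    (fun j => by simpa [← sub_eq_add_neg] using one_sub_pow_succ_ne_zero hp j) hs, ?_⟩
  have := (multipliable_one_add_of_summable hs).hasProd.tendsto_prod_nat
  simp only [← sub_eq_add_neg] at this ⊢
  exact this

lemma multipliable_theta_left {p : ℂ} (hp : ‖p‖ < 1) (z : ℂ) :
    Multipliable fun j : ℕ => 1 - z * p ^ j := by
  have := multipliable_one_add_of_summable (f := fun j : ℕ => -(z * p ^ j))
    (by simpa only [norm_neg, norm_mul] using (summable_norm_pow hp).mul_left ‖z‖)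
  simpa only [← sub_eq_add_neg] using this

lemma multipliable_theta_right {p : ℂ} (hp : ‖p‖ < 1) (z : ℂ) :
    Multipliable fun j : ℕ => 1 - p ^ (j + 1) / z := by
  convert multipliable_theta_left hp (p / z) using 2 with j
  ring

lemma multipliable_theta {p : ℂ} (hp : ‖p‖ < 1) (z : ℂ) :
    Multipliable fun j : ℕ => (1 - z * p ^ j) * (1 - p ^ (j + 1) / z) :=
  (multipliable_theta_left hp z).mul (multipliable_theta_right hp z)

lemma ellTheta_one (p : ℂ) : ellTheta 1 p = 0 :=
  tprod_of_exists_eq_zero ⟨0, by simp⟩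

lemma ellTheta_zero_right (z : ℂ) : ellTheta z 0 = 1 - z := by
  rw [ellTheta, tprod_eq_mulSingle 0]
  · simp
  · intro j hj; simp [hj]

lemma norm_sq_lt_one {p : ℂ} (hp : ‖p‖ < 1) : ‖p ^ 2‖ < 1 := norm_pow_succ_lt_one hp 1

/-- Each factor is a difference of squares. This is the bridge between nomes `p` and `p ^ 2`; it
also turns genericity at nome `p ^ 2` into nonvanishing of theta at nome `p` for both signs of the
argument. -/
lemma ellTheta_sq {p : ℂ} (hp : ‖p‖ < 1) (z : ℂ) :
    ellTheta (z ^ 2) (p ^ 2) = ellTheta z p * ellTheta (-z) p := by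
  rw [ellTheta, ellTheta, ellTheta, ← (multipliable_theta hp z).tprod_mul (multipliable_theta hp (-z))]
  refine tprod_congr fun j => ?_
  rw [div_neg]
  have : (p ^ 2) ^ (j + 1) / z ^ 2 = (p ^ (j + 1) / z) ^ 2 := by rw [div_pow]; ring
  rw [this]
  ring

/-! ### Jacobi's triple product -/

/-- The integer `k (k - 1) / 2`. -/
def triInt (k : ℤ) : ℤ := k * (k - 1) / 2

lemma two_mul_triInt (k : ℤ) : 2 * triInt k = k * (k - 1) :=
  Int.mul_ediv_cancel' (by simpa [mul_comm] using (Int.even_mul_pred_self k).two_dvd)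

lemma triInt_natCast (i : ℕ) : triInt i = (i.choose 2 : ℕ) := by
  have h := two_mul_triInt i
  have h2 : i.choose 2 * 2 = i * (i - 1) := by
    rw [Nat.choose_two_right]; exact Nat.div_mul_cancel (Nat.even_mul_pred_self i).two_dvd
  rcases i with _ | i
  · simpa using h
  · have h3 : (((i + 1).choose 2 * 2 : ℕ) : ℤ) = ((i + 1) * (i + 1 - 1) : ℕ) := by rw [h2]
    push_cast at h h3 ⊢
    have : 2 * triInt (i + 1) = 2 * ((i + 1).choose 2 : ℕ) := by
      rw [h]; linear_combination -h3
    omega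

/-- The general term of Jacobi's theta series. -/
noncomputable def thetaTerm (z p : ℂ) (k : ℤ) : ℂ := (-z) ^ k * p ^ triInt k

lemma prod_one_sub_mul_inv_pow {p z : ℂ} (hp : p ≠ 0) (hz : z ≠ 0) (n : ℕ) :
    ∏ j ∈ Finset.range n, (1 - z * (p ^ (j + 1))⁻¹) =
      (-z) ^ n * (p ^ triInt (-n))⁻¹ * ∏ j ∈ Finset.range n, (1 - p ^ (j + 1) / z) := by
  induction n with
  | zero => simp [triInt]
  | succ n ih =>
    have h : triInt (-((n + 1 : ℕ) : ℤ)) = triInt (-n) + ((n + 1 : ℕ) : ℤ) := by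
      have h1 := two_mul_triInt (-n)
      have h2 := two_mul_triInt (-((n + 1 : ℕ) : ℤ))
      have : 2 * triInt (-((n + 1 : ℕ) : ℤ)) = 2 * (triInt (-n) + ((n + 1 : ℕ) : ℤ)) := by
        rw [mul_add, h1, h2]; push_cast; ring
      omega
    rw [Finset.prod_range_succ, Finset.prod_range_succ, ih, h, zpow_add₀ hp, zpow_natCast]
    have hp' : p ^ (n + 1) ≠ 0 := pow_ne_zero _ hp
    have hp2 : p ^ triInt (-n) ≠ 0 := zpow_ne_zero _ hp
    field_simp
    ring

/-- The finite form of Jacobi's triple product. -/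
lemma finite_triple_product {p z : ℂ} (hp : p ≠ 0) (hz : z ≠ 0) (n : ℕ) :
    ∏ j ∈ Finset.range n, ((1 - z * p ^ j) * (1 - p ^ (j + 1) / z)) =
      ∑ i ∈ Finset.range (2 * n + 1), gaussBinom p (2 * n) i * thetaTerm z p (i - n) := by
  -- The shift by `p ^ (-n)` centres the product: its first `n` factors become, up to a monomial,
  -- the factors `1 - p ^ (j + 1) / z`, and the last `n` the factors `1 - z * p ^ j`.
  have h := prod_one_sub_mul_pow p (z * (p ^ n)⁻¹) (2 * n)
  have h1 : ∏ j ∈ Finset.range n, (1 - z * (p ^ n)⁻¹ * p ^ j) =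
      ∏ j ∈ Finset.range n, (1 - z * (p ^ (j + 1))⁻¹) := by
    rw [← Finset.prod_range_reflect]
    refine Finset.prod_congr rfl fun j hj => ?_
    have hj' := Finset.mem_range.mp hj
    have : p ^ n = p ^ (n - 1 - j) * p ^ (j + 1) := by rw [← pow_add]; congr 1; omega
    rw [this]
    have := pow_ne_zero (n - 1 - j) hp
    have := pow_ne_zero (j + 1) hp
    field_simp
  have h2 : ∏ j ∈ Finset.range n, (1 - z * (p ^ n)⁻¹ * p ^ (n + j)) =
      ∏ j ∈ Finset.range n, (1 - z * p ^ j) := by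
    refine Finset.prod_congr rfl fun j _ => ?_
    have := pow_ne_zero n hp
    rw [pow_add]
    field_simp
  rw [two_mul n, Finset.prod_range_add, h1, h2, prod_one_sub_mul_inv_pow hp hz] at h
  have hz' : (-z) ^ n ≠ 0 := pow_ne_zero _ (neg_ne_zero.mpr hz)
  have hp2 : p ^ triInt (-n) ≠ 0 := zpow_ne_zero _ hp
  rw [Finset.prod_mul_distrib]
  have h3 : (∏ j ∈ Finset.range n, (1 - z * p ^ j)) * ∏ j ∈ Finset.range n, (1 - p ^ (j + 1) / z)
      = ((-z) ^ n)⁻¹ * p ^ triInt (-n) * ((-z) ^ n * (p ^ triInt (-n))⁻¹ *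
        (∏ j ∈ Finset.range n, (1 - p ^ (j + 1) / z)) * ∏ j ∈ Finset.range n, (1 - z * p ^ j)) := by
    field_simp
  rw [h3, h, two_mul, Finset.mul_sum]
  refine Finset.sum_congr rfl fun i _ => ?_
  have h4 : triInt ((i : ℤ) - n) = triInt (-n) + (i.choose 2 : ℕ) - n * i := by
    have h5 := two_mul_triInt ((i : ℤ) - n)
    have h6 := two_mul_triInt (-n)
    have h7 := two_mul_triInt i
    rw [← triInt_natCast]
    have : 2 * triInt ((i : ℤ) - n) = 2 * (triInt (-n) + triInt i - n * i) := by
      rw [mul_sub, mul_add, h5, h6, h7]; ring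
    omega
  rw [thetaTerm, h4, zpow_sub₀ hp, zpow_add₀ hp, zpow_sub₀ (neg_ne_zero.mpr hz), zpow_natCast,
    zpow_natCast, zpow_natCast, neg_mul_eq_neg_mul, mul_pow, zpow_mul, zpow_natCast, zpow_natCast,
    inv_pow]
  have := pow_ne_zero i (pow_ne_zero n hp)
  field_simp

lemma summable_norm_nat_thetaTerm {p w : ℂ} (hp0 : p ≠ 0) (hw : w ≠ 0) (hp : ‖p‖ < 1) :
    Summable fun k : ℕ => ‖w ^ k * p ^ (k.choose 2)‖ := by
  refine summable_of_ratio_test_tendsto_lt_one (l := 0) zero_lt_one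
    (Eventually.of_forall fun k => norm_ne_zero_iff.mpr
      (mul_ne_zero (pow_ne_zero _ hw) (pow_ne_zero _ hp0))) ?_
  have h : ∀ k : ℕ, ‖‖w ^ (k + 1) * p ^ ((k + 1).choose 2)‖‖ / ‖‖w ^ k * p ^ (k.choose 2)‖‖ =
      ‖w‖ * ‖p‖ ^ k := by
    intro k
    have h1 : w ^ (k + 1) * p ^ ((k + 1).choose 2) = (w * p ^ k) * (w ^ k * p ^ (k.choose 2)) := by
      rw [Nat.choose_succ_succ' k 1, Nat.choose_one_right]; ring
    have h2 : ‖w ^ k * p ^ (k.choose 2)‖ ≠ 0 := norm_ne_zero_iff.mpr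
      (mul_ne_zero (pow_ne_zero _ hw) (pow_ne_zero _ hp0))
    rw [norm_norm, norm_norm, h1, norm_mul, mul_div_assoc, div_self h2, norm_mul, norm_pow, mul_one]
  simp_rw [h]
  simpa using (tendsto_pow_atTop_nhds_zero_of_lt_one (norm_nonneg p) hp).const_mul ‖w‖

lemma summable_norm_thetaTerm {p z : ℂ} (hp0 : p ≠ 0) (hz : z ≠ 0) (hp : ‖p‖ < 1) :
    Summable fun k : ℤ => ‖thetaTerm z p k‖ := by
  refine Summable.of_nat_of_neg ?_ ?_
  · refine (summable_norm_nat_thetaTerm hp0 (neg_ne_zero.mpr hz) hp).congr fun k => ?_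
    rw [thetaTerm, triInt_natCast, zpow_natCast, zpow_natCast]
  · refine (summable_norm_nat_thetaTerm hp0 (w := -p / z)
      (div_ne_zero (neg_ne_zero.mpr hp0) hz) hp).congr fun k => ?_
    have h1 : triInt (-k) = (k.choose 2 : ℕ) + k := by
      have h1 := two_mul_triInt (-k)
      have h2 := two_mul_triInt k
      rw [← triInt_natCast]
      have : 2 * triInt (-k) = 2 * (triInt k + k) := by rw [mul_add, h1, h2]; ring
      omega
    have h2 : (-p / z) ^ k = ((-z) ^ k)⁻¹ * p ^ k := by
      rw [← inv_pow, ← mul_pow]; congr 1; field_simp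
    rw [thetaTerm, h1, h2, zpow_add₀ hp0, zpow_neg, zpow_natCast, zpow_natCast, zpow_natCast]
    congr 1
    ring

/-- Jacobi's theta series. -/
noncomputable def thetaSeries (z p : ℂ) : ℂ := ∑' k : ℤ, thetaTerm z p k

/-- Jacobi's triple product identity. -/
lemma jacobi_triple_product {p : ℂ} (hp0 : p ≠ 0) (hp : ‖p‖ < 1) :
    ∃ c : ℂ, c ≠ 0 ∧ ∀ z : ℂ, z ≠ 0 → ellTheta z p = c * thetaSeries z p := by
  obtain ⟨c, hc, hlim⟩ := exists_tendsto_eulerProd hp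
  refine ⟨c⁻¹, inv_ne_zero hc, fun z hz => ?_⟩
  -- Extending the coefficients by zero to all integers allows dominated convergence: they are
  -- bounded uniformly in `n` and `k`, and tend to the inverse of the infinite Euler product for
  -- each `k`.
  set w : ℕ → ℤ → ℂ := fun n k =>
    if -(n : ℤ) ≤ k ∧ k ≤ n then gaussBinom p (2 * n) (k + n).toNat else 0 with hw
  have hw' : ∀ (n : ℕ) (k : ℤ), -(n : ℤ) ≤ k ∧ k ≤ n →
      w n k = eulerProd p (2 * n) * (eulerProd p (k + n).toNat)⁻¹ *
        (eulerProd p (n - k).toNat)⁻¹ := by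
    intro n k hk
    have h := gaussBinom_mul_eulerProd p (k + n).toNat (n - k).toNat
    rw [show (k + n).toNat + (n - k).toNat = 2 * n by omega] at h
    have h1 := eulerProd_ne_zero hp (k + n).toNat
    have h2 := eulerProd_ne_zero hp (n - k).toNat
    simp only [hw, if_pos hk]
    rw [← h]
    field_simp
  have hfin : ∀ n : ℕ, ∏ j ∈ Finset.range n, ((1 - z * p ^ j) * (1 - p ^ (j + 1) / z)) =
      ∑' k : ℤ, w n k * thetaTerm z p k := by
    intro n
    rw [finite_triple_product hp0 hz, tsum_eq_sum (s := Finset.Icc (-(n : ℤ)) n)]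
    · refine Finset.sum_bij (fun i _ => (i : ℤ) - n) ?_ ?_ ?_ ?_
      · intro i hi; simp only [Finset.mem_range] at hi; simp only [Finset.mem_Icc]; omega
      · intro i _ j _ h; omega
      · intro k hk
        simp only [Finset.mem_Icc] at hk
        exact ⟨(k + n).toNat, by simp only [Finset.mem_range]; omega, by omega⟩
      · intro i hi
        simp only [Finset.mem_range] at hi
        simp only [hw]
        rw [if_pos (by omega), sub_add_cancel, Int.toNat_natCast]
    · intro k hk
      simp only [Finset.mem_Icc] at hk
      simp only [hw, if_neg hk, zero_mul]
  have hb : ∃ B : ℝ, ∀ n, ‖eulerProd p n‖ ≤ B := by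
    obtain ⟨B, hB⟩ := (Metric.isBounded_range_of_tendsto _ hlim).exists_norm_le
    exact ⟨B, fun n => hB _ ⟨n, rfl⟩⟩
  have hb' : ∃ B : ℝ, ∀ n, ‖(eulerProd p n)⁻¹‖ ≤ B := by
    obtain ⟨B, hB⟩ := (Metric.isBounded_range_of_tendsto _ (hlim.inv₀ hc)).exists_norm_le
    exact ⟨B, fun n => hB _ ⟨n, rfl⟩⟩
  obtain ⟨B, hB⟩ := hb
  obtain ⟨B', hB'⟩ := hb'
  have hB0 : 0 ≤ B := (norm_nonneg _).trans (hB 0)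
  have hB0' : 0 ≤ B' := (norm_nonneg _).trans (hB' 0)
  have hconv : Tendsto (fun n : ℕ => ∑' k : ℤ, w n k * thetaTerm z p k) atTop
      (𝓝 (∑' k : ℤ, c⁻¹ * thetaTerm z p k)) := by
    refine tendsto_tsum_of_dominated_convergence
      (bound := fun k => B * B' * B' * ‖thetaTerm z p k‖)
      ((summable_norm_thetaTerm hp0 hz hp).mul_left _) ?_ ?_
    · intro k
      refine Tendsto.mul_const _ ?_
      have t1 : Tendsto (fun n : ℕ => 2 * n) atTop atTop :=
        tendsto_atTop_mono (fun n => by simp only [id]; omega) tendsto_id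
      have t2 : Tendsto (fun n : ℕ => (k + n).toNat) atTop atTop :=
        tendsto_atTop_atTop.mpr fun b => ⟨b + k.natAbs, fun n hn => by omega⟩
      have t3 : Tendsto (fun n : ℕ => ((n : ℤ) - k).toNat) atTop atTop :=
        tendsto_atTop_atTop.mpr fun b => ⟨b + k.natAbs, fun n hn => by omega⟩
      have t := ((hlim.comp t1).mul ((hlim.comp t2).inv₀ hc)).mul ((hlim.comp t3).inv₀ hc)
      rw [mul_inv_cancel₀ hc, one_mul] at t
      refine t.congr' ?_
      filter_upwards [eventually_ge_atTop k.natAbs] with n hn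
      exact (hw' n k (by omega)).symm
    · refine Eventually.of_forall fun n k => ?_
      rw [norm_mul]
      refine mul_le_mul_of_nonneg_right ?_ (norm_nonneg _)
      by_cases hk : -(n : ℤ) ≤ k ∧ k ≤ n
      · rw [hw' n k hk, norm_mul, norm_mul]
        gcongr <;> first | exact hB _ | exact hB' _
      · simp only [hw, if_neg hk, norm_zero]
        positivity
  have hprod := (multipliable_theta hp z).hasProd.tendsto_prod_nat
  simp_rw [hfin] at hprod
  rw [ellTheta, tendsto_nhds_unique hprod hconv, tsum_mul_left, thetaSeries]

/-! ### Products of two theta functions and the addition formulas -/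

/-- The pairs `(i, j)` of integers with `i + j` even, resp. odd, are parametrized by
`(u + v, u - v)`, resp. `(u + v + 1, u - v)`. -/
def parityMap : (ℤ × ℤ) ⊕ (ℤ × ℤ) → ℤ × ℤ :=
  Sum.elim (fun w => (w.1 + w.2, w.1 - w.2)) (fun w => (w.1 + w.2 + 1, w.1 - w.2))

lemma parityMap_bijective : Function.Bijective parityMap := by
  constructor
  · rintro (⟨u, v⟩ | ⟨u, v⟩) (⟨u', v'⟩ | ⟨u', v'⟩) h <;>
      simp only [parityMap, Sum.elim_inl, Sum.elim_inr, Prod.mk.injEq] at h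
    · congr 2 <;> omega
    · omega
    · omega
    · congr 2 <;> omega
  · rintro ⟨i, j⟩
    rcases Int.even_or_odd (i + j) with h | h
    · obtain ⟨t, ht⟩ := h
      refine ⟨Sum.inl (t, i - t), ?_⟩
      simp only [parityMap, Sum.elim_inl, Prod.mk.injEq]; omega
    · obtain ⟨t, ht⟩ := h
      refine ⟨Sum.inr (t, i - t - 1), ?_⟩
      simp only [parityMap, Sum.elim_inr, Prod.mk.injEq]; omega

/-- The exponents of `p` add up to `u(u-1) + v²`: the mixed terms in `u` and `v` cancel, so the
double series factors. In the odd case the sum is `u² + v(v+1)`. -/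
lemma thetaTerm_mul_even {p x y : ℂ} (hp : p ≠ 0) (hx : x ≠ 0) (hy : y ≠ 0) (u v : ℤ) :
    thetaTerm x p (u + v) * thetaTerm y p (u - v) =
      thetaTerm (-(x * y)) (p ^ 2) u * thetaTerm (-(p * (x / y))) (p ^ 2) v := by
  have hx' := neg_ne_zero.mpr hx
  have hy' := neg_ne_zero.mpr hy
  have h : triInt (u + v) + triInt (u - v) = 2 * triInt u + (2 * triInt v + v) := by
    have h1 := two_mul_triInt (u + v)
    have h2 := two_mul_triInt (u - v)
    have h3 := two_mul_triInt u
    have h4 := two_mul_triInt v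
    have : 2 * (triInt (u + v) + triInt (u - v)) = 2 * (2 * triInt u + (2 * triInt v + v)) := by
      rw [mul_add, h1, h2, h3, h4]; ring
    omega
  have h2 : ∀ k : ℤ, (p ^ 2) ^ k = p ^ (2 * k) := fun k => by
    rw [zpow_mul]; norm_cast
  have h3 : p ^ triInt (u + v) * p ^ triInt (u - v) =
      p ^ (2 * triInt u) * (p ^ (2 * triInt v) * p ^ v) := by
    rw [← zpow_add₀ hp, h, zpow_add₀ hp, zpow_add₀ hp]
  simp only [thetaTerm, neg_neg, h2]
  rw [zpow_add₀ hx', zpow_sub₀ hy', mul_zpow, mul_zpow, div_zpow]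
  have h4 : (-x) ^ v / (-y) ^ v = x ^ v / y ^ v := by rw [← div_zpow, ← div_zpow, neg_div_neg_eq]
  have h5 : (-x) ^ u * (-y) ^ u = x ^ u * y ^ u := by rw [← mul_zpow, ← mul_zpow, neg_mul_neg]
  linear_combination ((-x) ^ u * (-y) ^ u * ((-x) ^ v / (-y) ^ v)) * h3 +
    (p ^ (2 * triInt u) * (p ^ (2 * triInt v) * p ^ v)) *
      (((-x) ^ v / (-y) ^ v) * h5 + x ^ u * y ^ u * h4)

lemma thetaTerm_mul_odd {p x y : ℂ} (hp : p ≠ 0) (hx : x ≠ 0) (hy : y ≠ 0) (u v : ℤ) :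
    thetaTerm x p (u + v + 1) * thetaTerm y p (u - v) =
      -y * (thetaTerm (-(p * (x * y))) (p ^ 2) u * thetaTerm (-(x / y)) (p ^ 2) (v + 1)) := by
  have hx' := neg_ne_zero.mpr hx
  have hy' := neg_ne_zero.mpr hy
  have h : triInt (u + v + 1) + triInt (u - v) = 2 * triInt u + u + 2 * triInt (v + 1) := by
    have h1 := two_mul_triInt (u + v + 1)
    have h2 := two_mul_triInt (u - v)
    have h3 := two_mul_triInt u
    have h4 := two_mul_triInt (v + 1)
    have : 2 * (triInt (u + v + 1) + triInt (u - v)) =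
        2 * (2 * triInt u + u + 2 * triInt (v + 1)) := by
      rw [mul_add, h1, h2, h3, h4]; ring
    omega
  have h2 : ∀ k : ℤ, (p ^ 2) ^ k = p ^ (2 * k) := fun k => by
    rw [zpow_mul]; norm_cast
  have h3 : p ^ triInt (u + v + 1) * p ^ triInt (u - v) =
      p ^ (2 * triInt u) * p ^ u * p ^ (2 * triInt (v + 1)) := by
    rw [← zpow_add₀ hp, h, zpow_add₀ hp, zpow_add₀ hp]
  simp only [thetaTerm, neg_neg, h2]
  rw [add_assoc u v 1, zpow_add₀ hx', show u - v = u + 1 - (v + 1) by ring, zpow_sub₀ hy',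
    zpow_add_one₀ hy', mul_zpow p, mul_zpow x, div_zpow]
  rw [show u + 1 - (v + 1) = u - v by ring, ← add_assoc]
  have h4 : (-x) ^ (v + 1) / (-y) ^ (v + 1) = x ^ (v + 1) / y ^ (v + 1) := by
    rw [← div_zpow, ← div_zpow, neg_div_neg_eq]
  have h5 : (-x) ^ u * (-y) ^ u = x ^ u * y ^ u := by rw [← mul_zpow, ← mul_zpow, neg_mul_neg]
  linear_combination (-y * ((-x) ^ u * (-y) ^ u) * ((-x) ^ (v + 1) / (-y) ^ (v + 1))) * h3 +
    -y * (p ^ (2 * triInt u) * p ^ u * p ^ (2 * triInt (v + 1))) *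
      (((-x) ^ (v + 1) / (-y) ^ (v + 1)) * h5 + x ^ u * y ^ u * h4)

/-- The absolutely convergent double series is reindexed along `parityMap`, and each parity class
factors. -/
lemma thetaSeries_mul {p x y : ℂ} (hp0 : p ≠ 0) (hp : ‖p‖ < 1) (hx : x ≠ 0) (hy : y ≠ 0) :
    thetaSeries x p * thetaSeries y p =
      thetaSeries (-(x * y)) (p ^ 2) * thetaSeries (-(p * (x / y))) (p ^ 2) -
        y * thetaSeries (-(p * (x * y))) (p ^ 2) * thetaSeries (-(x / y)) (p ^ 2) := by
  have hp2 := norm_sq_lt_one hp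
  have hp20 := pow_ne_zero 2 hp0
  have hxy := mul_ne_zero hx hy
  have hxy' := div_ne_zero hx hy
  have S : ∀ {z : ℂ}, z ≠ 0 → Summable fun k : ℤ => ‖thetaTerm (-z) (p ^ 2) k‖ :=
    fun hz => summable_norm_thetaTerm hp20 (neg_ne_zero.mpr hz) hp2
  have hsx := summable_norm_thetaTerm hp0 hx hp
  have hsy := summable_norm_thetaTerm hp0 hy hp
  let e := Equiv.ofBijective parityMap parityMap_bijective
  have h1 : HasSum (fun w : ℤ × ℤ => thetaTerm x p w.1 * thetaTerm y p w.2)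
      (thetaSeries x p * thetaSeries y p) := by
    rw [thetaSeries, thetaSeries, tsum_mul_tsum_of_summable_norm hsx hsy]
    exact (summable_mul_of_summable_norm hsx hsy).hasSum
  have key : ∀ {z w : ℂ}, z ≠ 0 → w ≠ 0 →
      HasSum (fun t : ℤ × ℤ => thetaTerm (-z) (p ^ 2) t.1 * thetaTerm (-w) (p ^ 2) t.2)
        (thetaSeries (-z) (p ^ 2) * thetaSeries (-w) (p ^ 2)) := by
    intro z w hz hw
    rw [thetaSeries, thetaSeries, tsum_mul_tsum_of_summable_norm (S hz) (S hw)]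
    exact (summable_mul_of_summable_norm (S hz) (S hw)).hasSum
  have h2 : HasSum (fun t : ℤ × ℤ => thetaTerm x p (t.1 + t.2) * thetaTerm y p (t.1 - t.2))
      (thetaSeries (-(x * y)) (p ^ 2) * thetaSeries (-(p * (x / y))) (p ^ 2)) := by
    simp_rw [thetaTerm_mul_even hp0 hx hy]
    exact key hxy (mul_ne_zero hp0 hxy')
  have h3 : HasSum (fun t : ℤ × ℤ => thetaTerm x p (t.1 + t.2 + 1) * thetaTerm y p (t.1 - t.2))
      (-y * (thetaSeries (-(p * (x * y))) (p ^ 2) * thetaSeries (-(x / y)) (p ^ 2))) := by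
    simp_rw [thetaTerm_mul_odd hp0 hx hy]
    refine HasSum.mul_left _ ?_
    have := key (mul_ne_zero hp0 hxy) hxy'
    -- The odd terms carry the index `v + 1`; a shift of the second summation variable absorbs it.
    rw [← ((Equiv.refl ℤ).prodCongr (Equiv.addRight (1 : ℤ))).hasSum_iff] at this
    exact this
  rw [← e.hasSum_iff] at h1
  have h4 := HasSum.sum (f := (fun w : ℤ × ℤ => thetaTerm x p w.1 * thetaTerm y p w.2) ∘ e) h2 h3
  rw [h1.unique h4]
  ring

/-- A product of two theta functions, split according to the parity of the exponents. -/
lemma exists_ellTheta_mul {p : ℂ} (hp : ‖p‖ < 1) : ∃ g : ℂ → ℂ, ∀ x y : ℂ, x ≠ 0 → y ≠ 0 →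
    ellTheta x p * ellTheta y p = ellTheta (-(x * y)) (p ^ 2) * g (x / y) -
      y * g (x * y) * ellTheta (-(x / y)) (p ^ 2) := by
  by_cases hp0 : p = 0
  · subst hp0
    -- The nome `0` is not covered by the triple product as stated; there theta is `1 - z` and `g =
    -- 1` works.
    refine ⟨fun _ => 1, fun x y hx hy => ?_⟩
    rw [zero_pow two_ne_zero]
    simp only [ellTheta_zero_right]
    field_simp
    ring
  · obtain ⟨c, hc, h⟩ := jacobi_triple_product hp0 hp
    obtain ⟨d, hd, h'⟩ := jacobi_triple_product (pow_ne_zero 2 hp0) (norm_sq_lt_one hp)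
    refine ⟨fun z => c ^ 2 / d * thetaSeries (-(p * z)) (p ^ 2), fun x y hx hy => ?_⟩
    rw [h x hx, h y hy, h' _ (neg_ne_zero.mpr (mul_ne_zero hx hy)),
      h' _ (neg_ne_zero.mpr (div_ne_zero hx hy))]
    have := thetaSeries_mul hp0 hp hx hy
    field_simp at this ⊢
    linear_combination this

/-- The addition formula for theta functions. -/
lemma ellTheta_addition {p : ℂ} (hp : ‖p‖ < 1) {X Y Z u : ℂ} (hX : X ≠ 0) (hY : Y ≠ 0)
    (hZ : Z ≠ 0) (hu : u ≠ 0) :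
    ellTheta (X * u) p * ellTheta (X / u) p * (ellTheta (Y * Z) p * ellTheta (Y / Z) p) =
      ellTheta (X * Z) p * ellTheta (X / Z) p * (ellTheta (Y * u) p * ellTheta (Y / u) p) -
      Y / Z * (ellTheta (X * Y) p * ellTheta (X / Y) p * (ellTheta (Z * u) p * ellTheta (Z / u) p)) := by
  obtain ⟨g, h⟩ := exists_ellTheta_mul hp
  have key : ∀ A B : ℂ, A ≠ 0 → B ≠ 0 → ellTheta (A * B) p * ellTheta (A / B) p =
      ellTheta (-(A ^ 2)) (p ^ 2) * g (B ^ 2) - A / B * g (A ^ 2) * ellTheta (-(B ^ 2)) (p ^ 2) := by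
    intro A B hA hB
    rw [h _ _ (mul_ne_zero hA hB) (div_ne_zero hA hB)]
    rw [show A * B * (A / B) = A ^ 2 by field_simp, show A * B / (A / B) = B ^ 2 by field_simp]
  -- With `F(w) = θ(-w;p²)`, each product is `A` times the determinant of `(F(A²)/A, g(A²))` and
  -- `(F(B²)/B, g(B²))`. What remains is the Plücker relation.
  rw [key X u hX hu, key Y Z hY hZ, key X Z hX hZ, key Y u hY hu, key X Y hX hY, key Z u hZ hu]
  field_simp
  ring

/-- A three-term relation between theta functions of nomes `p` and `p ^ 2`. -/
lemma ellTheta_quadratic_addition {p : ℂ} (hp : ‖p‖ < 1) {A D E : ℂ} (hA : A ≠ 0) (hD : D ≠ 0)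
    (hE : E ≠ 0) :
    ellTheta E p * ellTheta (A * E / D) p * ellTheta (-(A * D)) (p ^ 2) -
      ellTheta A p * ellTheta D p * ellTheta (-(A * E ^ 2 / D)) (p ^ 2) =
      D * (ellTheta (A * E) p * ellTheta (E / D) p * ellTheta (-(A / D)) (p ^ 2)) := by
  obtain ⟨g, h⟩ := exists_ellTheta_mul hp
  rw [mul_comm (ellTheta E p), h _ _ (div_ne_zero (mul_ne_zero hA hE) hD) hE, h A D hA hD,
    h _ _ (mul_ne_zero hA hE) (div_ne_zero hE hD)]
  -- Only the three arguments `AD`, `A/D` and `AE²/D` occur in `g`, and all terms containing `g`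
  -- cancel.
  rw [show A * E / D * E = A * E ^ 2 / D by ring, show A * E / D / E = A / D by field_simp,
    show A * E * (E / D) = A * E ^ 2 / D by ring, show A * E / (E / D) = A * D by field_simp]
  field_simp
  ring

/-! ### Elliptic shifted factorials and inversion of the Bailey matrix -/

lemma ellPoch_zero (a q p : ℂ) : ellPoch a q p 0 = 1 := rfl

lemma ellPoch_succ (a q p : ℂ) (n : ℕ) :
    ellPoch a q p (n + 1) = ellPoch a q p n * ellTheta (a * q ^ n) p :=
  Finset.prod_range_succ _ _

lemma ellPoch_succ' (a q p : ℂ) (n : ℕ) :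
    ellPoch a q p (n + 1) = ellTheta a p * ellPoch (a * q) q p n := by
  rw [ellPoch, Finset.prod_range_succ', mul_comm, pow_zero, mul_one]
  congr 1
  exact Finset.prod_congr rfl fun j _ => by rw [pow_succ', mul_assoc]

lemma ellPoch_ne_zero {a q p : ℂ} {n : ℕ} (h : ∀ j < n, ellTheta (a * q ^ j) p ≠ 0) :
    ellPoch a q p n ≠ 0 :=
  Finset.prod_ne_zero_iff.mpr fun j hj => h j (Finset.mem_range.mp hj)

lemma ellPoch_sq {p : ℂ} (hp : ‖p‖ < 1) (a q : ℂ) (n : ℕ) :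
    ellPoch (a ^ 2) (q ^ 2) (p ^ 2) n = ellPoch a q p n * ellPoch (-a) q p n := by
  rw [ellPoch, ellPoch, ellPoch, ← Finset.prod_mul_distrib]
  refine Finset.prod_congr rfl fun j _ => ?_
  rw [show a ^ 2 * (q ^ 2) ^ j = (a * q ^ j) ^ 2 by rw [mul_pow, ← pow_mul, ← pow_mul, mul_comm 2],
    ellTheta_sq hp, neg_mul]

/-- The addition formula with `u ^ 2 = A`, `X = b * u`, `Z = t * u` and `Y = c * Z`. -/
lemma ellTheta_addition_mul {p : ℂ} (hp : ‖p‖ < 1) {A b c t : ℂ} (hA : A ≠ 0) (hb : b ≠ 0)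
    (hc : c ≠ 0) (ht : t ≠ 0) :
    ellTheta (b * A) p * ellTheta b p * (ellTheta (c * A * t ^ 2) p * ellTheta c p) =
      ellTheta (b * A * t) p * ellTheta (b / t) p * (ellTheta (c * A * t) p * ellTheta (c * t) p) -
      c * (ellTheta (b * (c * A * t)) p * ellTheta (b / (c * t)) p *
        (ellTheta (A * t) p * ellTheta t p)) := by
  -- Any square root of `A` will do: after simplification the arguments involve only `u * u`.
  obtain ⟨u, rfl⟩ := IsAlgClosed.exists_eq_mul_self A
  have hu := left_ne_zero_of_mul hA
  have h := ellTheta_addition hp (mul_ne_zero hb hu) (mul_ne_zero (mul_ne_zero hc ht) hu)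
    (mul_ne_zero ht hu) hu
  rw [show b * u * u = b * (u * u) by ring, show b * u / u = b by field_simp,
    show c * t * u * (t * u) = c * (u * u) * t ^ 2 by ring,
    show c * t * u / (t * u) = c by field_simp, show b * u * (t * u) = b * (u * u) * t by ring,
    show b * u / (t * u) = b / t by field_simp, show c * t * u * u = c * (u * u) * t by ring,
    show c * t * u / u = c * t by field_simp,
    show b * u * (c * t * u) = b * (c * (u * u) * t) by ring,
    show b * u / (c * t * u) = b / (c * t) by field_simp, show t * u * u = u * u * t by ring,
    show t * u / u = t by field_simp] at h
  exact h

/-- The entry `(s + i, s)` of the matrix of the elliptic WP Bailey transform. -/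
noncomputable def baileyEntry (a k q p : ℂ) (s i : ℕ) : ℂ :=
  ellPoch (k / a) q p i / ellPoch q q p i * (ellPoch k q p (2 * s + i) / ellPoch (a * q) q p (2 * s + i))

/-- The common factor of the two terms in the splitting of `baileyEntry`. -/
noncomputable def baileyEntryAux (a k q p : ℂ) (s i : ℕ) : ℂ :=
  ellPoch (k / a * q) q p i / ellPoch q q p i *
    (ellPoch k q p (2 * s + i + 1) / ellPoch (a * q) q p (2 * s + i))

/-- This is the addition formula at `A = a q^(2s)`, `c = k/a`, `t = q^(i+1)`, where `c A t²` is the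
argument of the well-poised factor. The two terms on the right are multiples of consecutive values
of `baileyEntryAux`, so summation by parts is possible for every `b`. -/
lemma baileyEntry_split {a k q p : ℂ} (hp : ‖p‖ < 1) (ha : a ≠ 0) (hk : k ≠ 0) (hq : q ≠ 0)
    (hq' : ∀ n : ℕ, ellTheta (q ^ (n + 1)) p ≠ 0) (ha' : ∀ n : ℕ, ellTheta (a * q ^ n) p ≠ 0)
    {b : ℂ} (hb : b ≠ 0) (s i : ℕ) :
    ellTheta (b * (a * q ^ (2 * s))) p * ellTheta b p *
      (ellTheta (k * q ^ (2 * (s + (i + 1)))) p * baileyEntry a k q p s (i + 1)) =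
    ellTheta (b * (a * q ^ (2 * s)) * q ^ (i + 1)) p * ellTheta (b / q ^ (i + 1)) p *
      baileyEntryAux a k q p s (i + 1) -
    k / a * (ellTheta (b * (k * q ^ (2 * s + (i + 1)))) p * ellTheta (b / (k / a * q ^ (i + 1))) p *
      baileyEntryAux a k q p s i) := by
  have h := ellTheta_addition_mul hp (mul_ne_zero ha (pow_ne_zero (2 * s) hq)) hb
    (div_ne_zero hk ha) (pow_ne_zero (i + 1) hq)
  rw [show k / a * (a * q ^ (2 * s)) * (q ^ (i + 1)) ^ 2 = k * q ^ (2 * (s + (i + 1))) by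
      field_simp; ring,
    show k / a * (a * q ^ (2 * s)) * q ^ (i + 1) = k * q ^ (2 * s + (i + 1)) by
      field_simp; ring,
    show a * q ^ (2 * s) * q ^ (i + 1) = a * q ^ (2 * s + (i + 1)) by ring] at h
  have h1 : ellPoch q q p i ≠ 0 := ellPoch_ne_zero fun j _ => by
    simpa only [pow_succ'] using hq' j
  have h2 : ellPoch (a * q) q p (2 * s + i) ≠ 0 := ellPoch_ne_zero fun j _ => by
    simpa only [pow_succ', mul_assoc] using ha' (j + 1)
  have h3 := hq' i
  have h4 := ha' (2 * s + (i + 1))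
  simp only [baileyEntry, baileyEntryAux]
  rw [ellPoch_succ' (k / a), ellPoch_succ q, ← add_assoc (2 * s) i 1, ellPoch_succ (a * q),
    ellPoch_succ (k / a * q), ellPoch_succ k q p (2 * s + i + 1),
    show q * q ^ i = q ^ (i + 1) by ring,
    show a * q * q ^ (2 * s + i) = a * q ^ (2 * s + (i + 1)) by ring,
    show k / a * q * q ^ i = k / a * q ^ (i + 1) by ring, add_assoc (2 * s) i 1]
  field_simp at h ⊢
  linear_combination (ellPoch (k * q / a) q p i * ellPoch k q p (2 * s + (i + 1))) * h

/-- Summation by parts for sums against `baileyEntry`. -/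
lemma sum_mul_baileyEntry {a k q p : ℂ} (hp : ‖p‖ < 1) (ha : a ≠ 0) (hk : k ≠ 0) (hq : q ≠ 0)
    (hq' : ∀ n : ℕ, ellTheta (q ^ (n + 1)) p ≠ 0) (ha' : ∀ n : ℕ, ellTheta (a * q ^ n) p ≠ 0)
    {b : ℂ} (hb : b ≠ 0) (s N : ℕ) (w : ℕ → ℂ) :
    ellTheta (b * (a * q ^ (2 * s))) p * ellTheta b p * ∑ i ∈ Finset.range (N + 1),
      w i * (ellTheta (k * q ^ (2 * (s + i))) p * baileyEntry a k q p s i) =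
    ∑ i ∈ Finset.range N,
      (w i * (ellTheta (b * (a * q ^ (2 * s)) * q ^ i) p * ellTheta (b / q ^ i) p) -
        k / a * w (i + 1) * (ellTheta (b * (k * q ^ (2 * s + (i + 1)))) p *
          ellTheta (b / (k / a * q ^ (i + 1))) p)) * baileyEntryAux a k q p s i +
      w N * (ellTheta (b * (a * q ^ (2 * s)) * q ^ N) p * ellTheta (b / q ^ N) p) *
        baileyEntryAux a k q p s N := by
  induction N with
  | zero =>
    simp only [zero_add, Finset.sum_range_one, Finset.sum_range_zero, baileyEntry, baileyEntryAux,
      ellPoch_zero, add_zero, pow_zero, mul_one, div_one, ellPoch_succ k]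
    ring
  | succ N ih =>
    rw [Finset.sum_range_succ, mul_add, ih, Finset.sum_range_succ]
    linear_combination w (N + 1) * baileyEntry_split hp ha hk hq hq' ha' hb s N

/-- The rows of the inverse of the elliptic WP Bailey matrix are orthogonal to its columns. -/
lemma sum_baileyEntry_inverse_eq_zero {a k q p : ℂ} (hp : ‖p‖ < 1) (ha : a ≠ 0) (hk : k ≠ 0)
    (hq : q ≠ 0) (hq' : ∀ n : ℕ, ellTheta (q ^ (n + 1)) p ≠ 0)
    (ha' : ∀ n : ℕ, ellTheta (a * q ^ n) p ≠ 0) (hk' : ∀ n : ℕ, ellTheta (k * q ^ n) p ≠ 0)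
    (s N : ℕ) :
    ∑ i ∈ Finset.range (N + 1 + 1),
      (ellPoch (a / k) q p (N + 1 - i) / ellPoch q q p (N + 1 - i) *
        (ellPoch a q p (2 * s + (N + 1) + i) / ellPoch (k * q) q p (2 * s + (N + 1) + i)) *
        (k / a) ^ (N + 1 - i)) *
      (ellTheta (k * q ^ (2 * (s + i))) p * baileyEntry a k q p s i) = 0 := by
  have hne : ellTheta (q ^ (N + 1) * (a * q ^ (2 * s))) p * ellTheta (q ^ (N + 1)) p ≠ 0 := by
    refine mul_ne_zero ?_ (hq' N)
    rw [show q ^ (N + 1) * (a * q ^ (2 * s)) = a * q ^ (N + 1 + 2 * s) by ring]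
    exact ha' _
  refine (mul_eq_zero.mp ?_).resolve_left hne
  -- The choice `b = q^(N+1)` turns the boundary term into a multiple of `θ(1) = 0`. It also makes
  -- each bracket vanish, since the weights satisfy exactly the resulting first-order recurrence.
  rw [sum_mul_baileyEntry hp ha hk hq hq' ha' (pow_ne_zero _ hq), div_self (pow_ne_zero _ hq),
    ellTheta_one, mul_zero, mul_zero, zero_mul, add_zero]
  refine Finset.sum_eq_zero fun i hi => mul_eq_zero_of_left (sub_eq_zero.mpr ?_) _
  obtain ⟨j, rfl⟩ := Nat.exists_eq_add_of_le (Nat.lt_succ_iff.mp (Finset.mem_range.mp hi))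
  rw [show i + j + 1 - i = j + 1 by omega, show i + j + 1 - (i + 1) = j by omega]
  have e1 : q ^ (i + j + 1) / q ^ i = q ^ (j + 1) := by
    rw [show i + j + 1 = i + (j + 1) by ring, pow_add q i]; field_simp
  have e2 : q ^ (i + j + 1) / (k / a * q ^ (i + 1)) = a / k * q ^ j := by
    rw [show i + j + 1 = (i + 1) + j by ring, pow_add q (i + 1)]; field_simp
  rw [e1, e2, show q ^ (i + j + 1) * (a * q ^ (2 * s)) * q ^ i =
      a * q ^ (2 * s + (i + j + 1) + i) by ring,
    show q ^ (i + j + 1) * (k * q ^ (2 * s + (i + 1))) =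
      k * q ^ (2 * s + (i + j + 1) + i + 1) by ring,
    ← add_assoc (2 * s + (i + j + 1)) i 1, ellPoch_succ (a / k), ellPoch_succ q, ellPoch_succ a,
    ellPoch_succ (k * q), show q * q ^ j = q ^ (j + 1) by ring,
    show k * q * q ^ (2 * s + (i + j + 1) + i) = k * q ^ (2 * s + (i + j + 1) + i + 1) by ring]
  have h1 : ellPoch q q p j ≠ 0 := ellPoch_ne_zero fun j _ => by
    simpa only [pow_succ'] using hq' j
  have h2 : ellPoch (k * q) q p (2 * s + (i + j + 1) + i) ≠ 0 := ellPoch_ne_zero fun j _ => by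
    simpa only [pow_succ', mul_assoc] using hk' (j + 1)
  have h3 := hq' j
  have h4 := hk' (2 * s + (i + j + 1) + i + 1)
  generalize 2 * s + (i + j + 1) + i = R at *
  rw [pow_succ (k / a)]
  field_simp

lemma sum_range_sum_range_triangle {M : Type*} [AddCommMonoid M] (n : ℕ) (f : ℕ → ℕ → M) :
    ∑ r ∈ Finset.range (n + 1), ∑ s ∈ Finset.range (r + 1), f r s =
      ∑ s ∈ Finset.range (n + 1), ∑ i ∈ Finset.range (n - s + 1), f (s + i) s := by
  rw [Finset.sum_sigma', Finset.sum_sigma']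
  refine Finset.sum_bij' (fun x _ => ⟨x.2, x.1 - x.2⟩) (fun x _ => ⟨x.1 + x.2, x.1⟩) ?_ ?_ ?_ ?_ ?_
  · rintro ⟨r, s⟩ h
    simp only [Finset.mem_sigma, Finset.mem_range] at h ⊢
    omega
  · rintro ⟨s, i⟩ h
    simp only [Finset.mem_sigma, Finset.mem_range] at h ⊢
    omega
  · rintro ⟨r, s⟩ h
    simp only [Finset.mem_sigma, Finset.mem_range] at h
    simp only [Sigma.mk.injEq, heq_eq_eq, and_true]
    omega
  · rintro ⟨s, i⟩ h
    simp only [Sigma.mk.injEq, heq_eq_eq, true_and]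
    omega
  · rintro ⟨r, s⟩ h
    simp only [Finset.mem_sigma, Finset.mem_range] at h
    simp only
    rw [show s + (r - s) = r by omega]

/-- In the generic case, the first of the two relations of a Bailey pair implies the second. -/
lemma isEllipticWPBaileyPair_of_beta {a k q p : ℂ} (hp : ‖p‖ < 1) (ha : a ≠ 0) (hk : k ≠ 0)
    (hq : q ≠ 0) (hq' : ∀ n : ℕ, ellTheta (q ^ (n + 1)) p ≠ 0)
    (ha' : ∀ n : ℕ, ellTheta (a * q ^ n) p ≠ 0) (hk' : ∀ n : ℕ, ellTheta (k * q ^ n) p ≠ 0)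
    {α β : ℕ → ℂ}
    (h : ∀ n : ℕ, β n = ∑ r ∈ Finset.range (n + 1),
      ellPoch (k / a) q p (n - r) / ellPoch q q p (n - r) *
        (ellPoch k q p (n + r) / ellPoch (a * q) q p (n + r)) * α r) :
    IsEllipticWPBaileyPair a k q p α β := by
  refine ⟨h, fun n => ?_⟩
  simp_rw [h, Finset.mul_sum]
  -- Orthogonality removes every coefficient of `α s` with `s < n`; only the diagonal one is left to
  -- compute.
  rw [sum_range_sum_range_triangle, Finset.sum_range_succ, Finset.sum_eq_zero, zero_add]
  · rw [Nat.sub_self, zero_add, Finset.sum_range_one, Nat.add_zero, Nat.sub_self]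
    simp only [ellPoch_zero, pow_zero]
    have e1 := (ellPoch_succ a q p (n + n)).symm.trans (ellPoch_succ' a q p (n + n))
    have e2 := (ellPoch_succ k q p (n + n)).symm.trans (ellPoch_succ' k q p (n + n))
    have h1 : ellPoch (a * q) q p (n + n) ≠ 0 := ellPoch_ne_zero fun j _ => by
      simpa only [pow_succ', mul_assoc] using ha' (j + 1)
    have h2 : ellPoch (k * q) q p (n + n) ≠ 0 := ellPoch_ne_zero fun j _ => by
      simpa only [pow_succ', mul_assoc] using hk' (j + 1)
    have h3 : ellTheta a p ≠ 0 := by simpa using ha' 0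
    have h4 : ellTheta k p ≠ 0 := by simpa using hk' 0
    rw [two_mul]
    generalize ellTheta (k * q ^ (n + n)) p = x at e2 ⊢
    generalize ellTheta (a * q ^ (n + n)) p = y at e1 ⊢
    generalize ellPoch (a * q) q p (n + n) = A at e1 h1 ⊢
    generalize ellPoch (k * q) q p (n + n) = K at e2 h2 ⊢
    field_simp
    linear_combination (-α n * ellPoch k q p (n + n) * x) * e1 - α n * ellTheta a p * A * e2
  · intro s hs
    obtain ⟨N, rfl⟩ := Nat.exists_eq_add_of_lt (Finset.mem_range.mp hs)
    have h0 := sum_baileyEntry_inverse_eq_zero hp ha hk hq hq' ha' hk' s N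
    rw [show s + N + 1 - s = N + 1 by omega]
    have h1 := congrArg (fun x => ellTheta (a * q ^ (2 * (s + N + 1))) p / ellTheta a p /
      ellTheta k p * α s * x) h0
    rw [mul_zero] at h1
    rw [← h1, Finset.mul_sum]
    refine Finset.sum_congr rfl fun i hi => ?_
    rw [show s + N + 1 - (s + i) = N + 1 - i by omega, show s + i - s = i by omega,
      show s + N + 1 + (s + i) = 2 * s + (N + 1) + i by ring, show s + i + s = 2 * s + i by ring,
      baileyEntry]
    ring

/-! ### The quadratic summation -/

/-- The relation between coefficients behind the quadratic summation. -/
lemma ellTheta_quadratic_contiguity {p : ℂ} (hp : ‖p‖ < 1) {q K M e : ℂ} (hq : q ≠ 0)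
    (hK : K ≠ 0) (hM : M ≠ 0) (he : e ≠ 0) :
    ellTheta (-(K * e)) p *
      (ellTheta (K * e / M) p * ellTheta (-(q * e)) p * ellTheta (K * M * q ^ 3) (p ^ 2) -
        ellTheta (K * q) p * ellTheta (-(M * q ^ 2)) p * ellTheta (K * q * e ^ 2 / M) (p ^ 2)) =
    q * ellTheta (-(K * e * q ^ 2)) p *
      (ellTheta (-K) p * ellTheta (M * q) p * ellTheta (K * e ^ 2 / (M * q)) (p ^ 2) -
        ellTheta e p * ellTheta (-(K * e / (M * q))) p * ellTheta (K * M * q) (p ^ 2)) := by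
  have h1 := ellTheta_quadratic_addition hp (A := K * q) (D := -(M * q ^ 2)) (E := -(q * e))
    (mul_ne_zero hK hq) (neg_ne_zero.mpr (mul_ne_zero hM (pow_ne_zero 2 hq)))
    (neg_ne_zero.mpr (mul_ne_zero hq he))
  have h2 := ellTheta_quadratic_addition hp (A := -K) (D := M * q) (E := e)
    (neg_ne_zero.mpr hK) (mul_ne_zero hM hq) he
  rw [show K * q * -(q * e) / -(M * q ^ 2) = K * e / M by field_simp,
    show -(K * q * -(M * q ^ 2)) = K * M * q ^ 3 by ring,
    show -(K * q * (-(q * e)) ^ 2 / -(M * q ^ 2)) = K * q * e ^ 2 / M by field_simp,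
    show K * q * -(q * e) = -(K * e * q ^ 2) by ring,
    show -(q * e) / -(M * q ^ 2) = e / (M * q) by field_simp,
    show -(K * q / -(M * q ^ 2)) = K / (M * q) by field_simp] at h1
  rw [show -K * e / (M * q) = -(K * e / (M * q)) by ring,
    show -(-K * (M * q)) = K * M * q by ring,
    show -(-K * e ^ 2 / (M * q)) = K * e ^ 2 / (M * q) by ring,
    show -K * e = -(K * e) by ring, show -(-K / (M * q)) = K / (M * q) by ring] at h2
  -- The right-hand sides of `h1` and `h2` both contain `θ(e/(Mq);p) θ(K/(Mq);p²)`, and these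
  -- multipliers make them cancel.
  linear_combination ellTheta (-(K * e)) p * h1 + q * ellTheta (-(K * e * q ^ 2)) p * h2

lemma ellTheta_sq_mul_pow {p : ℂ} (hp : ‖p‖ < 1) (x q : ℂ) (n : ℕ) :
    ellTheta (x ^ 2 * (q ^ 2) ^ n) (p ^ 2) = ellTheta (x * q ^ n) p * ellTheta (-(x * q ^ n)) p := by
  rw [← ellTheta_sq hp, mul_pow, ← pow_mul, ← pow_mul, mul_comm 2]

/-- The weight of the transformation of Bailey pairs, for the entry `(s + i + j, s + i)`. -/
noncomputable def quadWeight (k m q p : ℂ) (s i j : ℕ) : ℂ :=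
  ellPoch (k / m) q p j / ellPoch q q p j *
    (ellPoch k q p (2 * s + (i + j) + i) / ellPoch (m * q) q p (2 * s + (i + j) + i))

lemma ellTheta_ne_zero_of_sq {p : ℂ} (hp : ‖p‖ < 1) {x q : ℂ} {n : ℕ}
    (h : ellTheta (x ^ 2 * (q ^ 2) ^ n) (p ^ 2) ≠ 0) :
    ellTheta (x * q ^ n) p ≠ 0 ∧ ellTheta (-(x * q ^ n)) p ≠ 0 := by
  rw [ellTheta_sq_mul_pow hp] at h
  exact ⟨left_ne_zero_of_mul h, right_ne_zero_of_mul h⟩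

lemma ellTheta_pow_ne_zero {p q : ℂ} (hp : ‖p‖ < 1)
    (hq' : ∀ n : ℕ, ellTheta ((q ^ 2) ^ (n + 1)) (p ^ 2) ≠ 0) (n : ℕ) :
    ellTheta (q ^ (n + 1)) p ≠ 0 := by
  have h := ellTheta_ne_zero_of_sq hp (x := 1) (q := q) (n := n + 1) (by simpa using hq' n)
  simpa using h.1

/-- Neighbouring weights differ by a few theta factors, so the bracket from summation by parts in
the sum of length `N + 1` reduces to one side of `ellTheta_quadratic_contiguity` with `K = k q^R`,
`M = m q^R`, `e = q^j`. `quadWeight_lower` does the same for the sum of length `N`, with `e =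
q^(j+1)`. -/
lemma quadWeight_upper {k m q p : ℂ} (hp : ‖p‖ < 1)
    (hq' : ∀ n : ℕ, ellTheta ((q ^ 2) ^ (n + 1)) (p ^ 2) ≠ 0)
    (hm' : ∀ n : ℕ, ellTheta (m ^ 2 * (q ^ 2) ^ n) (p ^ 2) ≠ 0) (s i j R : ℕ)
    (hR : R = 2 * s + (i + j) + i) :
    quadWeight k m q p s i (j + 1) * (ellTheta (k * q ^ R * (m * q ^ R) * q ^ 3) (p ^ 2) *
        ellTheta ((q ^ 2) ^ (j + 1)) (p ^ 2)) -
      quadWeight k m q p s (i + 1) j * (ellTheta (m ^ 2 * (q ^ 2) ^ (R + 2)) (p ^ 2) *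
        ellTheta (k * q ^ R * q * (q ^ j) ^ 2 / (m * q ^ R)) (p ^ 2)) =
    quadWeight k m q p s i j * ellTheta (k * q ^ R) p / ellTheta (m * q ^ R * q) p *
      (ellTheta (k / m * q ^ j) p * ellTheta (-(q * q ^ j)) p *
          ellTheta (k * q ^ R * (m * q ^ R) * q ^ 3) (p ^ 2) -
        ellTheta (k * q ^ R * q) p * ellTheta (-(m * q ^ R * q ^ 2)) p *
          ellTheta (k * q ^ R * q * (q ^ j) ^ 2 / (m * q ^ R)) (p ^ 2)) := by
  have h1 := ellTheta_sq_mul_pow hp 1 q (j + 1)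
  rw [one_pow, one_mul, one_mul, pow_succ' q j] at h1
  have h2 := ellTheta_sq_mul_pow hp m q (R + 2)
  rw [show m * q ^ (R + 2) = m * q ^ R * q ^ 2 by ring] at h2
  have n1 := ellTheta_pow_ne_zero hp hq' j
  rw [pow_succ'] at n1
  have n2 := (ellTheta_ne_zero_of_sq hp (hm' (R + 1))).1
  have n3 := (ellTheta_ne_zero_of_sq hp (hm' (R + 2))).1
  rw [show m * q ^ (R + 1) = m * q ^ R * q by ring] at n2
  rw [show m * q ^ (R + 2) = m * q ^ R * q ^ 2 by ring] at n3
  rw [h1, h2, quadWeight, quadWeight, quadWeight,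
    show 2 * s + (i + (j + 1)) + i = R + 1 by omega,
    show 2 * s + (i + 1 + j) + (i + 1) = R + 1 + 1 by omega, ← hR]
  simp only [ellPoch_succ]
  rw [show m * q * q ^ R = m * q ^ R * q by ring,
    show m * q * q ^ (R + 1) = m * q ^ R * q ^ 2 by ring,
    show k * q ^ (R + 1) = k * q ^ R * q by ring]
  generalize ellTheta (m * q ^ R * q) p = t1 at *
  generalize ellTheta (m * q ^ R * q ^ 2) p = t2 at *
  generalize ellTheta (q * q ^ j) p = t3 at *
  simp only [div_eq_mul_inv, mul_inv]
  have i2 : t2 * t2⁻¹ = 1 := mul_inv_cancel₀ n3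
  have i3 : t3 * t3⁻¹ = 1 := mul_inv_cancel₀ n1
  grind

lemma quadWeight_lower {k m q p : ℂ} (hp : ‖p‖ < 1)
    (hq' : ∀ n : ℕ, ellTheta ((q ^ 2) ^ (n + 1)) (p ^ 2) ≠ 0)
    (hm' : ∀ n : ℕ, ellTheta (m ^ 2 * (q ^ 2) ^ n) (p ^ 2) ≠ 0) (s i j R : ℕ)
    (hR : R = 2 * s + (i + (j + 1)) + i) :
    quadWeight k m q p s i (j + 1) * (ellTheta (k ^ 2 * (q ^ 2) ^ R) (p ^ 2) *
        ellTheta (k * q ^ R * (q ^ (j + 1)) ^ 2 / (m * q ^ R * q)) (p ^ 2)) -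
      quadWeight k m q p s (i + 1) j * (ellTheta (k * q ^ R * (m * q ^ R) * q) (p ^ 2) *
        ellTheta ((k / m) ^ 2 * (q ^ 2) ^ j) (p ^ 2)) =
    quadWeight k m q p s i (j + 1) * ellTheta (k * q ^ R) p / ellTheta (m * q ^ R * q) p *
      (ellTheta (-(k * q ^ R)) p * ellTheta (m * q ^ R * q) p *
          ellTheta (k * q ^ R * (q ^ (j + 1)) ^ 2 / (m * q ^ R * q)) (p ^ 2) -
        ellTheta (q ^ (j + 1)) p * ellTheta (-(k / m * q ^ j)) p *
          ellTheta (k * q ^ R * (m * q ^ R) * q) (p ^ 2)) := by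
  have h1 := ellTheta_sq_mul_pow hp k q R
  have h2 := ellTheta_sq_mul_pow hp (k / m) q j
  have n1 := ellTheta_pow_ne_zero hp hq' j
  have n2 := (ellTheta_ne_zero_of_sq hp (hm' (R + 1))).1
  rw [show m * q ^ (R + 1) = m * q ^ R * q by ring] at n2
  rw [h1, h2, quadWeight, quadWeight,
    show 2 * s + (i + 1 + j) + (i + 1) = R + 1 by omega, ← hR]
  simp only [ellPoch_succ]
  rw [show m * q * q ^ R = m * q ^ R * q by ring, show q * q ^ j = q ^ (j + 1) by ring]
  generalize ellTheta (m * q ^ R * q) p = t1 at *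
  generalize ellTheta (q ^ (j + 1)) p = t3 at *
  simp only [div_eq_mul_inv, mul_inv]
  have i1 : t1 * t1⁻¹ = 1 := mul_inv_cancel₀ n2
  have i3 : t3 * t3⁻¹ = 1 := mul_inv_cancel₀ n1
  grind

lemma quadWeight_contiguity_succ {k m q p : ℂ} (hp : ‖p‖ < 1) (hk : k ≠ 0) (hm : m ≠ 0)
    (hq : q ≠ 0) (hq' : ∀ n : ℕ, ellTheta ((q ^ 2) ^ (n + 1)) (p ^ 2) ≠ 0)
    (hm' : ∀ n : ℕ, ellTheta (m ^ 2 * (q ^ 2) ^ n) (p ^ 2) ≠ 0) (s i j R : ℕ)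
    (hR : R = 2 * s + (i + (j + 1)) + i) :
    ellTheta (-(k * q ^ R * q ^ (j + 1))) p *
      (quadWeight k m q p s i (j + 1 + 1) * (ellTheta (k * q ^ R * (m * q ^ R) * q ^ 3) (p ^ 2) *
        ellTheta ((q ^ 2) ^ (j + 1 + 1)) (p ^ 2)) -
      quadWeight k m q p s (i + 1) (j + 1) * (ellTheta (m ^ 2 * (q ^ 2) ^ (R + 2)) (p ^ 2) *
        ellTheta (k * q ^ R * q * (q ^ (j + 1)) ^ 2 / (m * q ^ R)) (p ^ 2))) =
    q * ellTheta (-(k * q ^ R * q ^ (j + 1) * q ^ 2)) p *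
      (quadWeight k m q p s i (j + 1) * (ellTheta (k ^ 2 * (q ^ 2) ^ R) (p ^ 2) *
        ellTheta (k * q ^ R * (q ^ (j + 1)) ^ 2 / (m * q ^ R * q)) (p ^ 2)) -
      quadWeight k m q p s (i + 1) j * (ellTheta (k * q ^ R * (m * q ^ R) * q) (p ^ 2) *
        ellTheta ((k / m) ^ 2 * (q ^ 2) ^ j) (p ^ 2))) := by
  have hqR := pow_ne_zero R hq
  have h := ellTheta_quadratic_contiguity hp hq (mul_ne_zero hk hqR) (mul_ne_zero hm hqR)
    (pow_ne_zero (j + 1) hq)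
  rw [show k * q ^ R * q ^ (j + 1) / (m * q ^ R) = k / m * q ^ (j + 1) by field_simp,
    show k * q ^ R * q ^ (j + 1) / (m * q ^ R * q) = k / m * q ^ j by rw [pow_succ]; field_simp] at h
  rw [quadWeight_upper hp hq' hm' s i (j + 1) R hR, quadWeight_lower hp hq' hm' s i j R hR]
  linear_combination (quadWeight k m q p s i (j + 1) * ellTheta (k * q ^ R) p /
    ellTheta (m * q ^ R * q) p) * h

/-- The end of the range is the case `e = 1`, where `θ(1) = 0` removes the term that would need a
weight beyond the range. It matches the last bracket of the longer sum with the boundary term of the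
shorter one. -/
lemma quadWeight_contiguity_zero {k m q p : ℂ} (hp : ‖p‖ < 1) (hk : k ≠ 0) (hm : m ≠ 0)
    (hq : q ≠ 0) (hq' : ∀ n : ℕ, ellTheta ((q ^ 2) ^ (n + 1)) (p ^ 2) ≠ 0)
    (hm' : ∀ n : ℕ, ellTheta (m ^ 2 * (q ^ 2) ^ n) (p ^ 2) ≠ 0) (s i R : ℕ)
    (hR : R = 2 * s + i + i) :
    ellTheta (-(k * q ^ R)) p *
      (quadWeight k m q p s i 1 * (ellTheta (k * q ^ R * (m * q ^ R) * q ^ 3) (p ^ 2) *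
        ellTheta (q ^ 2) (p ^ 2)) -
      quadWeight k m q p s (i + 1) 0 * (ellTheta (m ^ 2 * (q ^ 2) ^ (R + 2)) (p ^ 2) *
        ellTheta (k * q ^ R * q / (m * q ^ R)) (p ^ 2))) =
    q * ellTheta (-(k * q ^ R * q ^ 2)) p *
      (quadWeight k m q p s i 0 * (ellTheta (k ^ 2 * (q ^ 2) ^ R) (p ^ 2) *
        ellTheta (k * q ^ R / (m * q ^ R * q)) (p ^ 2))) := by
  have hqR := pow_ne_zero R hq
  have h := ellTheta_quadratic_contiguity hp hq (mul_ne_zero hk hqR) (mul_ne_zero hm hqR)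
    one_ne_zero
  have h1 := quadWeight_upper (k := k) hp hq' hm' s i 0 R hR
  have h2 := ellTheta_sq_mul_pow hp k q R
  have n2 := (ellTheta_ne_zero_of_sq hp (hm' (R + 1))).1
  rw [show m * q ^ (R + 1) = m * q ^ R * q by ring] at n2
  simp only [ellTheta_one, pow_zero, one_pow, mul_one, zero_add, pow_one, zero_mul, sub_zero] at h h1
  rw [show k / m = k * q ^ R / (m * q ^ R) by field_simp] at h1
  rw [h1, h2]
  generalize ellTheta (m * q ^ R * q) p = t at *
  have i1 : t * t⁻¹ = 1 := mul_inv_cancel₀ n2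
  simp only [div_eq_mul_inv _ t]
  linear_combination (quadWeight k m q p s i 0 * ellTheta (k * q ^ R) p * t⁻¹) * h +
    (q * ellTheta (-(k * q ^ R * q ^ 2)) p * quadWeight k m q p s i 0 * ellTheta (k * q ^ R) p *
      ellTheta (-(k * q ^ R)) p * ellTheta (k * q ^ R / (m * q ^ R * q)) (p ^ 2)) * i1

/-- The sum over `i` of the product of the quadratic weights with the entries of the Bailey
matrix at `(k * m * q, m ^ 2; q ^ 2, p ^ 2)`. -/
noncomputable def quadSum (k m q p : ℂ) (s N : ℕ) : ℂ :=
  ∑ i ∈ Finset.range (N + 1), quadWeight k m q p s i (N - i) * (k * q / m) ^ i *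
    (ellTheta (m ^ 2 * (q ^ 2) ^ (2 * (s + i))) (p ^ 2) *
      baileyEntry (k * m * q) (m ^ 2) (q ^ 2) (p ^ 2) s i)

/-- Both sums are summed by parts, with `b = q^(2N+2)` on the left and `b = k q^(2N)/(mq)` on the
right. These produce exactly the theta factors in the ratio of consecutive entries of the target
Bailey matrix. The coefficients of each `baileyEntryAux` then agree by contiguity. -/
lemma quadSum_succ {k m q p : ℂ} (hp : ‖p‖ < 1) (hk : k ≠ 0) (hm : m ≠ 0)
    (hq : q ≠ 0) (hq' : ∀ n : ℕ, ellTheta ((q ^ 2) ^ (n + 1)) (p ^ 2) ≠ 0)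
    (ha' : ∀ n : ℕ, ellTheta (k * m * q * (q ^ 2) ^ n) (p ^ 2) ≠ 0)
    (hm' : ∀ n : ℕ, ellTheta (m ^ 2 * (q ^ 2) ^ n) (p ^ 2) ≠ 0) (s N : ℕ) :
    ellTheta (-(k * q ^ (2 * (s + N)))) p *
      (ellTheta ((q ^ 2) ^ (N + 1) * (k * m * q * (q ^ 2) ^ (2 * s))) (p ^ 2) *
        ellTheta ((q ^ 2) ^ (N + 1)) (p ^ 2) * quadSum k m q p s (N + 1)) =
    q * ellTheta (-(k * q ^ (2 * (s + (N + 1))))) p *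
      (ellTheta (k / (m * q) * (q ^ 2) ^ N * (k * m * q * (q ^ 2) ^ (2 * s))) (p ^ 2) *
        ellTheta (k / (m * q) * (q ^ 2) ^ N) (p ^ 2) * quadSum k m q p s N) := by
  have ha : k * m * q ≠ 0 := mul_ne_zero (mul_ne_zero hk hm) hq
  have hq2 := pow_ne_zero 2 hq
  have hp2 := norm_sq_lt_one hp
  -- The factor `k/a` of summation by parts is here `m/(kq)`, which cancels one power of the base
  -- `kq/m` of the weight.
  have hc : ∀ (w : ℂ) (i : ℕ),
      m ^ 2 / (k * m * q) * (w * (k * q / m) ^ (i + 1)) = w * (k * q / m) ^ i := by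
    intro w i
    rw [pow_succ (k * q / m)]
    generalize (k * q / m) ^ i = x
    field_simp
  rw [quadSum, quadSum, sum_mul_baileyEntry hp2 ha (pow_ne_zero 2 hm) hq2 hq' ha'
    (pow_ne_zero _ hq2), sum_mul_baileyEntry hp2 ha (pow_ne_zero 2 hm) hq2 hq' ha'
    (mul_ne_zero (div_ne_zero hk (mul_ne_zero hm hq)) (pow_ne_zero _ hq2)),
    div_self (pow_ne_zero _ hq2), ellTheta_one, mul_zero, mul_zero, zero_mul, add_zero,
    Finset.sum_range_succ, mul_add (ellTheta _ _), mul_add (q * _), Finset.mul_sum, Finset.mul_sum]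
  congr 1
  · refine Finset.sum_congr rfl fun i hi => ?_
    obtain ⟨j, rfl⟩ := Nat.exists_eq_add_of_lt (Finset.mem_range.mp hi)
    have h := quadWeight_contiguity_succ hp hk hm hq hq' hm' s i j _ rfl
    rw [show i + j + 1 + 1 - i = j + 1 + 1 by omega, show i + j + 1 + 1 - (i + 1) = j + 1 by omega,
      show i + j + 1 - i = j + 1 by omega, show i + j + 1 - (i + 1) = j by omega, hc, hc]
    have e1 : (q ^ 2) ^ (i + j + 1 + 1) * (k * m * q * (q ^ 2) ^ (2 * s)) * (q ^ 2) ^ i =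
        k * q ^ (2 * s + (i + (j + 1)) + i) * (m * q ^ (2 * s + (i + (j + 1)) + i)) * q ^ 3 := by
      ring
    have e2 : (q ^ 2) ^ (i + j + 1 + 1) / (q ^ 2) ^ i = (q ^ 2) ^ (j + 1 + 1) := by
      rw [show i + j + 1 + 1 = i + (j + 1 + 1) by ring, pow_add _ i]; field_simp
    have e3 : (q ^ 2) ^ (i + j + 1 + 1) * (m ^ 2 * (q ^ 2) ^ (2 * s + (i + 1))) =
        m ^ 2 * (q ^ 2) ^ (2 * s + (i + (j + 1)) + i + 2) := by ring
    have e4 : (q ^ 2) ^ (i + j + 1 + 1) / (m ^ 2 / (k * m * q) * (q ^ 2) ^ (i + 1)) =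
        k * q ^ (2 * s + (i + (j + 1)) + i) * q * (q ^ (j + 1)) ^ 2 /
          (m * q ^ (2 * s + (i + (j + 1)) + i)) := by
      rw [show i + j + 1 + 1 = (i + 1) + (j + 1) by ring, pow_add _ (i + 1)]; field_simp; ring
    have e5 : k / (m * q) * (q ^ 2) ^ (i + j + 1) * (k * m * q * (q ^ 2) ^ (2 * s)) * (q ^ 2) ^ i =
        k ^ 2 * (q ^ 2) ^ (2 * s + (i + (j + 1)) + i) := by field_simp; ring
    have e6 : k / (m * q) * (q ^ 2) ^ (i + j + 1) / (q ^ 2) ^ i =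
        k * q ^ (2 * s + (i + (j + 1)) + i) * (q ^ (j + 1)) ^ 2 /
          (m * q ^ (2 * s + (i + (j + 1)) + i) * q) := by
      rw [show i + j + 1 = i + (j + 1) by ring, pow_add _ i]; field_simp; ring
    have e7 : k / (m * q) * (q ^ 2) ^ (i + j + 1) * (m ^ 2 * (q ^ 2) ^ (2 * s + (i + 1))) =
        k * q ^ (2 * s + (i + (j + 1)) + i) * (m * q ^ (2 * s + (i + (j + 1)) + i)) * q := by
      field_simp; ring
    have e8 : k / (m * q) * (q ^ 2) ^ (i + j + 1) / (m ^ 2 / (k * m * q) * (q ^ 2) ^ (i + 1)) =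
        (k / m) ^ 2 * (q ^ 2) ^ j := by
      rw [show i + j + 1 = (i + 1) + j by ring, pow_add _ (i + 1)]; field_simp
    rw [e1, e2, e3, e4, e5, e6, e7, e8, show k * q ^ (2 * (s + (i + j + 1))) =
        k * q ^ (2 * s + (i + (j + 1)) + i) * q ^ (j + 1) by ring,
      show k * q ^ (2 * (s + (i + j + 1 + 1))) =
        k * q ^ (2 * s + (i + (j + 1)) + i) * q ^ (j + 1) * q ^ 2 by ring]
    linear_combination ((k * q / m) ^ i *
      baileyEntryAux (k * m * q) (m ^ 2) (q ^ 2) (p ^ 2) s i) * h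
  · have h := quadWeight_contiguity_zero hp hk hm hq hq' hm' s N _ rfl
    rw [show N + 1 - N = 1 by omega, show N + 1 - (N + 1) = 0 by omega, Nat.sub_self, hc]
    have e1 : (q ^ 2) ^ (N + 1) * (k * m * q * (q ^ 2) ^ (2 * s)) * (q ^ 2) ^ N =
        k * q ^ (2 * s + N + N) * (m * q ^ (2 * s + N + N)) * q ^ 3 := by ring
    have e2 : (q ^ 2) ^ (N + 1) / (q ^ 2) ^ N = q ^ 2 := by
      rw [pow_succ]; field_simp
    have e3 : (q ^ 2) ^ (N + 1) * (m ^ 2 * (q ^ 2) ^ (2 * s + (N + 1))) =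
        m ^ 2 * (q ^ 2) ^ (2 * s + N + N + 2) := by ring
    have e4 : (q ^ 2) ^ (N + 1) / (m ^ 2 / (k * m * q) * (q ^ 2) ^ (N + 1)) =
        k * q ^ (2 * s + N + N) * q / (m * q ^ (2 * s + N + N)) := by
      field_simp
    have e5 : k / (m * q) * (q ^ 2) ^ N * (k * m * q * (q ^ 2) ^ (2 * s)) * (q ^ 2) ^ N =
        k ^ 2 * (q ^ 2) ^ (2 * s + N + N) := by field_simp; ring
    have e6 : k / (m * q) * (q ^ 2) ^ N / (q ^ 2) ^ N =
        k * q ^ (2 * s + N + N) / (m * q ^ (2 * s + N + N) * q) := by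
      field_simp
    rw [e1, e2, e3, e4, e5, e6, show k * q ^ (2 * (s + N)) = k * q ^ (2 * s + N + N) by ring,
      show k * q ^ (2 * (s + (N + 1))) = k * q ^ (2 * s + N + N) * q ^ 2 by ring]
    linear_combination ((k * q / m) ^ N *
      baileyEntryAux (k * m * q) (m ^ 2) (q ^ 2) (p ^ 2) s N) * h

/-- Both sides satisfy the same first-order recurrence in `N`, and the factor independent of `N` is
fixed by the single term at `N = 0`. -/
lemma quadSum_eq {k m q p : ℂ} (hp : ‖p‖ < 1) (hk : k ≠ 0) (hm : m ≠ 0)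
    (hq : q ≠ 0) (hq' : ∀ n : ℕ, ellTheta ((q ^ 2) ^ (n + 1)) (p ^ 2) ≠ 0)
    (ha' : ∀ n : ℕ, ellTheta (k * m * q * (q ^ 2) ^ n) (p ^ 2) ≠ 0)
    (hk' : ∀ n : ℕ, ellTheta (k ^ 2 * (q ^ 2) ^ n) (p ^ 2) ≠ 0)
    (hm' : ∀ n : ℕ, ellTheta (m ^ 2 * (q ^ 2) ^ n) (p ^ 2) ≠ 0) (s N : ℕ) :
    quadSum k m q p s N = ellTheta (-(k * q ^ (2 * (s + N)))) p * q ^ N *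
      baileyEntry (k * m * q) (k ^ 2) (q ^ 2) (p ^ 2) s N *
      (ellTheta (m ^ 2) (p ^ 2) / ellTheta (-k) p *
        (ellPoch (-(m * q)) q p (2 * s) / ellPoch (-(k * q)) q p (2 * s))) := by
  induction N with
  | zero =>
    have h1 := (ellPoch_succ (m ^ 2) (q ^ 2) (p ^ 2) (2 * s)).symm.trans
      (ellPoch_succ' (m ^ 2) (q ^ 2) (p ^ 2) (2 * s))
    have h2 := (ellPoch_succ (-k) q p (2 * s)).symm.trans (ellPoch_succ' (-k) q p (2 * s))
    rw [← mul_pow, ellPoch_sq hp (m * q)] at h1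
    have n1 : ellTheta (-k) p ≠ 0 := by
      simpa using (ellTheta_ne_zero_of_sq hp (hk' 0)).2
    have n2 : ellPoch (-(k * q)) q p (2 * s) ≠ 0 := ellPoch_ne_zero fun j _ => by
      simpa only [pow_succ', mul_assoc, neg_mul] using (ellTheta_ne_zero_of_sq hp (hk' (j + 1))).2
    have n3 : ellPoch (m * q) q p (2 * s) ≠ 0 := ellPoch_ne_zero fun j _ => by
      simpa only [pow_succ', mul_assoc] using (ellTheta_ne_zero_of_sq hp (hm' (j + 1))).1
    simp only [quadSum, quadWeight, baileyEntry, zero_add, Finset.sum_range_one, Nat.sub_self,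
      ellPoch_zero, pow_zero, Nat.add_zero, ellPoch_sq hp k]
    rw [neg_mul, neg_mul] at h2
    generalize ellTheta (m ^ 2 * (q ^ 2) ^ (2 * s)) (p ^ 2) = x at *
    generalize ellTheta (-(k * q ^ (2 * s))) p = y at *
    generalize ellPoch (m ^ 2) (q ^ 2) (p ^ 2) (2 * s) = M at *
    generalize ellPoch (k * m * q * q ^ 2) (q ^ 2) (p ^ 2) (2 * s) = A at *
    generalize ellPoch (m * q) q p (2 * s) = z at *
    generalize ellPoch (-(k * q)) q p (2 * s) = t at *
    generalize ellPoch (-(m * q)) q p (2 * s) = v at *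
    field_simp
    linear_combination (ellPoch k q p (2 * s) * ellTheta (-k) p * t * A⁻¹) * h1 -
      ellPoch k q p (2 * s) * ellTheta (m ^ 2) (p ^ 2) * z * v * A⁻¹ * h2
  | succ N ih =>
    have h := quadSum_succ hp hk hm hq hq' ha' hm' s N
    have e1 : k / (m * q) * (q ^ 2) ^ N * (k * m * q * (q ^ 2) ^ (2 * s)) =
        k ^ 2 * (q ^ 2) ^ (2 * s + N) := by field_simp; ring
    have e2 : (q ^ 2) ^ (N + 1) * (k * m * q * (q ^ 2) ^ (2 * s)) =
        k * m * q * (q ^ 2) ^ (2 * s + N + 1) := by ring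
    have e3 : k ^ 2 / (k * m * q) = k / (m * q) := by field_simp
    have n1 := (ellTheta_ne_zero_of_sq hp (hk' (2 * (s + N)))).2
    have n2 := hq' N
    have n3 := ha' (2 * s + N + 1)
    have hB : baileyEntry (k * m * q) (k ^ 2) (q ^ 2) (p ^ 2) s (N + 1) *
        (ellTheta (k * m * q * (q ^ 2) ^ (2 * s + N + 1)) (p ^ 2) *
          ellTheta ((q ^ 2) ^ (N + 1)) (p ^ 2)) =
        baileyEntry (k * m * q) (k ^ 2) (q ^ 2) (p ^ 2) s N *
          (ellTheta (k ^ 2 * (q ^ 2) ^ (2 * s + N)) (p ^ 2) *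
            ellTheta (k / (m * q) * (q ^ 2) ^ N) (p ^ 2)) := by
      rw [baileyEntry, baileyEntry, e3, ← add_assoc]
      simp only [ellPoch_succ]
      rw [show q ^ 2 * (q ^ 2) ^ N = (q ^ 2) ^ (N + 1) by ring,
        show k * m * q * q ^ 2 * (q ^ 2) ^ (2 * s + N) =
          k * m * q * (q ^ 2) ^ (2 * s + N + 1) by ring]
      generalize ellTheta ((q ^ 2) ^ (N + 1)) (p ^ 2) = x at *
      generalize ellTheta (k * m * q * (q ^ 2) ^ (2 * s + N + 1)) (p ^ 2) = y at *
      simp only [div_eq_mul_inv, mul_inv]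
      have i1 : x * x⁻¹ = 1 := mul_inv_cancel₀ n2
      have i2 : y * y⁻¹ = 1 := mul_inv_cancel₀ n3
      grind
    rw [e1, e2, ih] at h
    refine mul_left_cancel₀ (mul_ne_zero n1 (mul_ne_zero n3 n2)) ?_
    rw [mul_assoc, h, pow_succ q N]
    linear_combination (-q * ellTheta (-(k * q ^ (2 * (s + (N + 1))))) p *
      (ellTheta (-(k * q ^ (2 * (s + N)))) p * q ^ N *
      (ellTheta (m ^ 2) (p ^ 2) / ellTheta (-k) p *
        (ellPoch (-(m * q)) q p (2 * s) / ellPoch (-(k * q)) q p (2 * s))))) * hB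

/-! ### The transformation of Bailey pairs -/

theorem theorem5p2 (a k m q p : ℂ) (α β : ℕ → ℂ)
    (ha : a ≠ 0) (hk : k ≠ 0) (hq : q ≠ 0) (hp : ‖p‖ < 1)
    (hm : m = a / (k * q))
    -- the parameters are generic: no denominator vanishes
    (hq' : ∀ n : ℕ, ellTheta (q ^ (2 * (n + 1))) (p ^ 2) ≠ 0)
    (ha' : ∀ n : ℕ, ellTheta (a * q ^ (2 * n)) (p ^ 2) ≠ 0)
    (hk' : ∀ n : ℕ, ellTheta (k ^ 2 * q ^ (2 * n)) (p ^ 2) ≠ 0)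
    (hm' : ∀ n : ℕ, ellTheta (m ^ 2 * q ^ (2 * n)) (p ^ 2) ≠ 0)
    (h : IsEllipticWPBaileyPair a (m ^ 2) (q ^ 2) (p ^ 2) α β) :
    IsEllipticWPBaileyPair a (k ^ 2) (q ^ 2) (p ^ 2)
      (fun n => ellPoch (-(m * q)) q p (2 * n) / ellPoch (-(k * q)) q p (2 * n) *
        (a / (m ^ 2 * q)) ^ n * α n)
      (fun n => ellTheta (-k) p / ellTheta (-(k * q ^ (2 * n))) p * (q ^ n)⁻¹ *
        ∑ r ∈ Finset.range (n + 1),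
          ellTheta (m ^ 2 * q ^ (4 * r)) (p ^ 2) / ellTheta (m ^ 2) (p ^ 2) *
            (ellPoch (k / m) q p (n - r) / ellPoch q q p (n - r)) *
            (ellPoch k q p (n + r) / ellPoch (m * q) q p (n + r)) *
            (a / m ^ 2) ^ r * β r) := by
  have hm0 : m ≠ 0 := hm ▸ div_ne_zero ha (mul_ne_zero hk hq)
  obtain rfl : a = k * m * q := by rw [hm]; field_simp
  clear hm
  simp only [pow_mul q 2] at hq' ha' hk' hm'
  have n1 : ellTheta (-k) p ≠ 0 := by simpa using (ellTheta_ne_zero_of_sq hp (hk' 0)).2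
  have n2 : ellTheta (m ^ 2) (p ^ 2) ≠ 0 := by simpa using hm' 0
  have hd : k * m * q / m ^ 2 = k * q / m := by field_simp
  have hd' : k * m * q / (m ^ 2 * q) = k / m := by field_simp
  refine isEllipticWPBaileyPair_of_beta (norm_sq_lt_one hp) ha (pow_ne_zero 2 hk)
    (pow_ne_zero 2 hq) hq' ha' hk' fun n => ?_
  have n3 := (ellTheta_ne_zero_of_sq hp (hk' (2 * n))).2
  simp only [h.1, Finset.mul_sum]
  rw [sum_range_sum_range_triangle]
  refine Finset.sum_congr rfl fun s hs => ?_
  obtain ⟨N, rfl⟩ := Nat.exists_eq_add_of_le (Nat.lt_succ_iff.mp (Finset.mem_range.mp hs))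
  have hS := quadSum_eq hp hk hm0 hq hq' ha' hk' hm' s N
  rw [Nat.add_sub_cancel_left, hd, hd']
  -- The coefficient of `α s` is a multiple of `quadSum`: since `a/m² = kq/m`, the power with
  -- exponent `s + i` splits into a prefactor and the power inside `quadSum`.
  trans ellTheta (-k) p / ellTheta (-(k * q ^ (2 * (s + N)))) p * (q ^ (s + N))⁻¹ *
    (k * q / m) ^ s * α s / ellTheta (m ^ 2) (p ^ 2) * quadSum k m q p s N
  · rw [quadSum, Finset.mul_sum]
    refine Finset.sum_congr rfl fun i hi => ?_
    have hi' := Finset.mem_range.mp hi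
    rw [show s + N - (s + i) = N - i by omega, show s + i - s = i by omega,
      show s + N + (s + i) = 2 * s + (i + (N - i)) + i by omega,
      show s + i + s = 2 * s + i by ring, baileyEntry, quadWeight, pow_add _ s i,
      show q ^ (4 * (s + i)) = (q ^ 2) ^ (2 * (s + i)) by ring]
    ring
  · rw [hS, show s + N + s = 2 * s + N by ring, baileyEntry, pow_add q s N,
      show (k * q / m) ^ s = (k / m) ^ s * q ^ s by rw [← mul_pow]; ring]
    have hqs := pow_ne_zero s hq
    have hqN := pow_ne_zero N hq
    generalize ellTheta (-(k * q ^ (2 * (s + N)))) p = x at *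
    generalize (k / m) ^ s = y
    generalize ellTheta (m ^ 2) (p ^ 2) = z at *
    generalize ellTheta (-k) p = t at *
    generalize q ^ s = u at *
    generalize q ^ N = v at *
    simp only [div_eq_mul_inv, mul_inv]
    have i1 : x * x⁻¹ = 1 := mul_inv_cancel₀ n3
    have i2 : z * z⁻¹ = 1 := mul_inv_cancel₀ n2
    have i3 : t * t⁻¹ = 1 := mul_inv_cancel₀ n1
    have i4 : u * u⁻¹ = 1 := mul_inv_cancel₀ hqs
    have i5 : v * v⁻¹ = 1 := mul_inv_cancel₀ hqN
    grind
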